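/- Let $q\ge 1$ and $d\ge 0$ be integers. Equip $\mathbb{R}^{q\times q}$ with the Frobenius norm $\|\cdot\|_F$ and $\mathbb{R}^d$ with the Euclidean norm $\|\cdot\|_{\ell_2}$. For a linear map $A$ between such spaces let $\|A\|_2$ be its operator (spectral) norm with respect to these norms, and for a linear operator $A:\mathbb{R}^{q\times q}\to\mathbb{R}^{q\times q}$ let $\|A\|_{\mathrm{euc}}=\big(\sum_{i,j=1}^q\|A(e_ie_j')\|_F^2\big)^{1/2}$ be its Euclidean (Hilbert--Schmidt) norm. A linear map $\mathcal{L}:\mathbb{R}^{q\times q}\to\mathbb{R}^d$ with component functionals $\mathcal{L}_i\in\mathbb{R}^{q\times q}$, i.e. $\mathcal{L}(X)_i=\langle \mathcal{L}_i,X\rangle=\mathrm{tr}(\mathcal{L}_i'X)$, is called normalized if $\sum_{i=1}^d\mathcal{L}_i\mathcal{L}_i'=qI$ and $\sum_{i=1}^d\mathcal{L}_i'\mathcal{L}_i=qI$. Its restricted isometry constant $\delta_1(\mathcal{L})$ of order $1$ is the smallest $\delta$ such that $1-\delta\le \|\mathcal{L}(X)\|_{\ell_2}^2/\|X\|_F^2\le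 1+\delta$ for all nonzero $X\in\mathbb{R}^{q\times q}$ of rank at most $1$. A linear operator $\mathcal{M}:\mathbb{R}^{q\times q}\to\mathbb{R}^{q\times q}$ is a rank-preserver if $\mathrm{rank}(\mathcal{M}(X))=\mathrm{rank}(X)$ for all $X\in\mathbb{R}^{q\times q}$; it is an orthogonal rank-preserver if there are orthogonal matrices $U_1,U_2\in\mathbb{R}^{q\times q}$ such that $\mathcal{M}(X)=U_1XU_2$ for all $X$, or $\mathcal{M}(X)=U_1X'U_2$ for all $X$. Proposition. Suppose $\mathcal{L},\mathcal{L}^\star:\mathbb{R}^{q\times q}\to\mathbb{R}^d$ are normalized linear maps such that (i) $\delta_1(\mathcal{L}^\star)\le 1/10$, and (ii) $\mathcal{L}=\mathcal{L}^\star\circ(\mathsf{I}+\mathsf{E})\circ\mathcal{M}$, where $\mathsf{I}$ is the identity operator, $\mathcal{M}:\mathbb{R}^{q\times q}\to\mathbb{R}^{q\times q}$ is a linear rank-preserver, and $\mathsf{E}:\mathbb{R}^{q\times q}\to\mathbb{R}^{q\times q}$ is a linear operator with $\|\mathsf{E}\|_{\mathrm{euc}}\le \dfrac{1}{150\sqrt{q}\,\|\mathcal{L}^\star\|_2}$.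 Then there exists an orthogonal rank-preserver $\mathcal{M}^{\mathrm{or}}:\mathbb{R}^{q\times q}\to\mathbb{R}^{q\times q}$ such that $$\|\mathcal{M}^{\mathrm{or}}-\mathcal{M}\|_2\le 300\sqrt{q}\,\|\mathcal{L}^\star\|_2\,\|\mathsf{E}\|_{\mathrm{euc}}.$$ -/

import Mathlib

open scoped Matrix

/- Matrices carry the Frobenius norm. -/
attribute [local instance] Matrix.frobeniusNormedAddCommGroup Matrix.frobeniusNormedSpace

noncomputable section

/-- The space of real `q × q` matrices. -/
abbrev Mat (q : ℕ) : Type := Matrix (Fin q) (Fin q) ℝ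

/-- The spectral (operator) norm of a linear map between finite-dimensional normed spaces. It is
used with the Frobenius norm on matrices and the Euclidean norm on vectors. -/
def spectralNorm2 {V W : Type*} [NormedAddCommGroup V] [NormedSpace ℝ V] [FiniteDimensional ℝ V]
    [NormedAddCommGroup W] [NormedSpace ℝ W] (A : V →ₗ[ℝ] W) : ℝ :=
  ‖LinearMap.toContinuousLinearMap A‖

/-- The Euclidean (Frobenius, Hilbert-Schmidt) norm of a linear operator on `q × q` matrices: the
square root of the sum of the squares of its entries in the orthonormal basis of matrix units. -/
def euclideanNorm {q : ℕ} (A : Mat q →ₗ[ℝ] Mat q) : ℝ :=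
  √(∑ i, ∑ j, ‖A (Matrix.single i j 1)‖ ^ 2)

/-- The matrix representing the `i`-th component functional of `L`, so that
`(L X) i` is the trace inner product of `componentMatrix L i` and `X`. -/
def componentMatrix {q d : ℕ} (L : Mat q →ₗ[ℝ] EuclideanSpace ℝ (Fin d)) (i : Fin d) : Mat q :=
  Matrix.of fun j k => L (Matrix.single j k 1) i

/-- `L` is normalized: `∑ Lᵢ Lᵢ' = q I` and `∑ Lᵢ' Lᵢ = q I`. -/
def IsNormalizedMap {q d : ℕ} (L : Mat q →ₗ[ℝ] EuclideanSpace ℝ (Fin d)) : Prop :=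
  ∑ i, componentMatrix L i * (componentMatrix L i)ᵀ = (q : ℝ) • (1 : Mat q) ∧
  ∑ i, (componentMatrix L i)ᵀ * componentMatrix L i = (q : ℝ) • (1 : Mat q)

/-- The restricted isometry constant of order `k` of `L`: the smallest `δ` with
`1 - δ ≤ ‖L X‖² / ‖X‖² ≤ 1 + δ` for all nonzero `X` of rank at most `k`. -/
def restrictedIsometryConst {q d : ℕ} (k : ℕ) (L : Mat q →ₗ[ℝ] EuclideanSpace ℝ (Fin d)) : ℝ :=
  sInf {δ : ℝ | ∀ X : Mat q, X ≠ 0 → X.rank ≤ k →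
    1 - δ ≤ ‖L X‖ ^ 2 / ‖X‖ ^ 2 ∧ ‖L X‖ ^ 2 / ‖X‖ ^ 2 ≤ 1 + δ}

/-- `M` is a rank-preserver. -/
def IsRankPreserver {q : ℕ} (M : Mat q →ₗ[ℝ] Mat q) : Prop :=
  ∀ X : Mat q, (M X).rank = X.rank

/-- `M` is an orthogonal rank-preserver: `X ↦ U₁ X U₂` or `X ↦ U₁ X' U₂` with `U₁`, `U₂`
orthogonal. -/
def IsOrthogonalRankPreserver {q : ℕ} (M : Mat q →ₗ[ℝ] Mat q) : Prop :=
  ∃ U₁ ∈ Matrix.orthogonalGroup (Fin q) ℝ, ∃ U₂ ∈ Matrix.orthogonalGroup (Fin q) ℝ,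
    (∀ X : Mat q, M X = U₁ * X * U₂) ∨ (∀ X : Mat q, M X = U₁ * Xᵀ * U₂)

end

/-! ### Linear maps preserving rank. -/

section RankPreserver

/-! By `Matrix.exists_mul_mul_of_rank_eq`, a rank-preserver is `X ↦ A * X * B` with `A`, `B`
invertible, or the same in `Xᵀ`; the transpose can be absorbed into `L`. Take singular value
decompositions `A = U₁ * diagonal x * V₁` and `B = U₂ * diagonal y * V₂`. If every `x i * y j` is
close to 1, then `M` is close to `X ↦ (U₁ * V₁) * X * (U₂ * V₂)`.

To see that they are, let `C i j` be the squared norm of `Lstar ∘ (I + E)` at the rotated matrix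
unit `U₁ * single i j 1 * V₂`. Normalization of `L` gives the matrix `x i ^ 2 * y j ^ 2 * C i j` row
and column sums exactly `q`; normalization of `Lstar` gives `C` the same sums up to an error
controlled by `E`. The restricted isometry bound, applied to rank-one matrices, keeps all `C i j ≥ 1
/ 2`. Such a uniform lower bound makes diagonal scaling contractive: the spread of `x` is at most
about half that of `y`, and conversely, so both are of the order of the error
(`spread_le_of_row_sums`, `abs_mul_sub_one_le_of_doubly_stochastic`). -/

theorem Matrix.exists_eq_vecMulVec_of_rank_le_one {K m n : Type*} [Field K] [Fintype n]
    [DecidableEq n] {A : Matrix m n K} (h : A.rank ≤ 1) :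
    ∃ u v, A = Matrix.vecMulVec u v := by
  obtain ⟨u, hu⟩ := (finrank_le_one_iff (K := K)).1 h
  choose c hc using fun j : n => hu ⟨A.mulVecLin (Pi.single j 1), LinearMap.mem_range_self _ _⟩
  refine ⟨u, c, ?_⟩
  ext i j
  have := congrFun (congrArg Subtype.val (hc j)) i
  simp at this
  simp [Matrix.vecMulVec_apply, ← this, mul_comm]

theorem Matrix.mul_eq_mul_of_rank_le_one {K m n : Type*} [Field K] [Fintype n] [DecidableEq n]
    {A : Matrix m n K} (h : A.rank ≤ 1) (r s : m) (c d : n) :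
    A r c * A s d = A r d * A s c := by
  obtain ⟨u, v, rfl⟩ := Matrix.exists_eq_vecMulVec_of_rank_le_one h
  simp only [Matrix.vecMulVec_apply]
  ring

variable {K n : Type*} [Field K] [Fintype n] [DecidableEq n]

/-- A linear map that keeps the rank of rank-one matrices at most one and fixes the diagonal matrix
units is conjugation by a diagonal matrix, possibly composed with the transposition. -/
theorem Matrix.exists_diagonal_of_rank_le_one [Nonempty n]
    (f : Matrix n n K →ₗ[K] Matrix n n K)
    (hf : ∀ x y : n → K, (f (Matrix.vecMulVec x y)).rank ≤ 1)
    (hd : ∀ i, f (Matrix.single i i 1) = Matrix.single i i 1) :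
    ∃ A B : Matrix n n K, (∀ X, f X = A * X * B) ∨ (∀ X, f X = A * Xᵀ * B) := by
  -- All relations below are vanishing 2 × 2 minors of images of rank-one matrices built from one,
  -- two or four matrix units.
  have h1 (i j r s c d : n) : f (single i j 1) r c * f (single i j 1) s d
      = f (single i j 1) r d * f (single i j 1) s c := by
    rw [single_eq_single_vecMulVec_single]
    exact mul_eq_mul_of_rank_le_one (hf _ _) _ _ _ _
  have h2 (i j k r s c d : n) :
      (f (single i j 1) r c + f (single i k 1) r c) * (f (single i j 1) s d + f (single i k 1) s d)
      = (f (single i j 1) r d + f (single i k 1) r d) *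
        (f (single i j 1) s c + f (single i k 1) s c) := by
    have := mul_eq_mul_of_rank_le_one (hf (Pi.single i 1) (Pi.single j 1 + Pi.single k 1)) r s c d
    simpa [vecMulVec_add, ← single_eq_single_vecMulVec_single] using this
  have h2' (i j k r s c d : n) :
      (f (single i k 1) r c + f (single j k 1) r c) * (f (single i k 1) s d + f (single j k 1) s d)
      = (f (single i k 1) r d + f (single j k 1) r d) *
        (f (single i k 1) s c + f (single j k 1) s c) := by
    have := mul_eq_mul_of_rank_le_one (hf (Pi.single i 1 + Pi.single j 1) (Pi.single k 1)) r s c d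
    simpa [add_vecMulVec, ← single_eq_single_vecMulVec_single] using this
  have h4 (i k j l r s c d : n) :
      (f (single i j 1) r c + f (single i l 1) r c +
        (f (single k j 1) r c + f (single k l 1) r c)) *
      (f (single i j 1) s d + f (single i l 1) s d +
        (f (single k j 1) s d + f (single k l 1) s d)) =
      (f (single i j 1) r d + f (single i l 1) r d +
        (f (single k j 1) r d + f (single k l 1) r d)) *
      (f (single i j 1) s c + f (single i l 1) s c +
        (f (single k j 1) s c + f (single k l 1) s c)) := by
    have := mul_eq_mul_of_rank_le_one
      (hf (Pi.single i 1 + Pi.single k 1) (Pi.single j 1 + Pi.single l 1)) r s c d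
    simp only [add_vecMulVec, vecMulVec_add, ← single_eq_single_vecMulVec_single, map_add,
      add_apply] at this
    linear_combination this
  -- Adding the fixed unit at `(i, i)` changes a minor of the image only through that pivot, so
  -- entries off row and column `i` vanish. The unit at `(j, j)` does the same for `j`; only
  -- positions `(i, j)` and `(j, i)` survive both.
  have hs (i j : n) (hij : i ≠ j) (k l : n) (h : ¬ (k = i ∧ l = j)) (h' : ¬ (k = j ∧ l = i)) :
      f (single i j 1) k l = 0 := by
    have e1 (hk : k ≠ i) (hl : l ≠ i) : f (single i j 1) k l = 0 := by
      have a1 := h2 i i j i k i l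
      have a2 := h1 i j i k i l
      simp only [hd, single_apply, hk.symm, hl.symm, and_false, false_and, and_self,
        if_true, if_false, zero_add] at a1
      linear_combination a1 - a2
    have e2 (hk : k ≠ j) (hl : l ≠ j) : f (single i j 1) k l = 0 := by
      have a1 := h2' j i j j k j l
      have a2 := h1 i j j k j l
      simp only [hd, single_apply, hk.symm, hl.symm, and_false, false_and, and_self,
        if_true, if_false, zero_add] at a1
      linear_combination a1 - a2
    grind
  set a : n → n → K := fun i j => f (single i j 1) i j with ha
  set b : n → n → K := fun i j => f (single i j 1) j i with hb
  have hfs (i j : n) (hij : i ≠ j) :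
      f (single i j 1) = single i j (a i j) + single j i (b i j) := by
    ext k l
    simp only [add_apply, single_apply]
    have := hs i j hij k l
    grind
  have hab (i j : n) (hij : i ≠ j) : a i j * b i j = 0 := by
    have := h1 i j i j i j
    rw [hs i j hij i i (by grind) (by grind), zero_mul] at this
    exact this.symm
  have hpair (i j : n) (hij : i ≠ j) : (a i j + b j i) * (a j i + b i j) = 1 := by
    have := h4 i j i j i j i j
    simp [hfs _ _ hij, hfs _ _ hij.symm, hd, hij, hij.symm] at this
    linear_combination -this
  -- Cocycle identities: they let `a` or `b` factor through a base index, which produces the two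
  -- diagonal matrices.
  have htrip (i j k : n) (hij : i ≠ j) (hik : i ≠ k) (hjk : j ≠ k) : a k j = a k i * a i j := by
    have := h4 i k i j i k i j
    simp [hfs _ _ hij, hfs _ _ hik.symm, hfs _ _ hjk.symm, hd, hij, hij.symm, hik, hik.symm, hjk,
      hjk.symm] at this
    linear_combination this
  have htrip' (i j k : n) (hij : i ≠ j) (hik : i ≠ k) (hjk : j ≠ k) : b k j = b k i * b i j := by
    have := h4 i k i j i j i k
    simp [hfs _ _ hij, hfs _ _ hik.symm, hfs _ _ hjk.symm, hd, hij, hij.symm, hik, hik.symm, hjk,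
      hjk.symm] at this
    linear_combination this
  -- One row cannot mix plain and transposed behaviour; together with `hpair` and `hab` this forces
  -- a single global choice.
  have hmix (i j k : n) (hij : i ≠ j) (hik : i ≠ k) (hjk : j ≠ k) : a i j * b i k = 0 := by
    have := h2 i j k i k i j
    simp [hfs _ _ hij, hfs _ _ hik, hij, hij.symm, hik, hik.symm, hjk, hjk.symm] at this
    exact mul_eq_zero.2 this
  have had (i : n) : a i i = 1 := by simp [ha, hd]
  have hbd (i : n) : b i i = 1 := by simp [hb, hd]
  clear_value a b
  clear h1 h2 h2' h4 hs
  obtain ⟨i₀⟩ := ‹Nonempty n›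
  by_cases hP : ∃ i j, i ≠ j ∧ a i j ≠ 0
  · have hsymm (i j : n) (hij : i ≠ j) (h : a i j ≠ 0) : a j i ≠ 0 := by
      have := hab i j hij
      have := hpair i j hij
      have := hab j i hij.symm
      grind
    have hstep (i j k : n) (hij : i ≠ j) (hik : i ≠ k) (h : a i j ≠ 0) : a i k ≠ 0 := by
      by_cases hjk : j = k
      · exact hjk ▸ h
      · have h0 : b i k = 0 := (mul_eq_zero.1 (hmix i j k hij hik hjk)).resolve_left h
        have := hpair i k hik
        have := hab k i hik.symm
        grind
    have hall (k l : n) (hkl : k ≠ l) : a k l ≠ 0 := by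
      obtain ⟨i, j, hij, h⟩ := hP
      by_cases hik : i = k
      · subst hik
        exact hstep _ _ _ hij hkl h
      · exact hstep _ _ _ (Ne.symm hik) hkl (hsymm _ _ hik (hstep _ _ _ hij hik h))
    have hb0 (k l : n) (hkl : k ≠ l) : b k l = 0 :=
      (mul_eq_zero.1 (hab k l hkl)).resolve_left (hall k l hkl)
    have hmul (k l : n) : a k l = a k i₀ * a i₀ l := by
      by_cases h1 : k = i₀
      · subst h1; simp [had]
      by_cases h2 : l = i₀
      · subst h2; simp [had]
      by_cases h3 : k = l
      · subst h3
        have := hpair k i₀ h1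
        rw [hb0 _ _ h1, hb0 _ _ (Ne.symm h1)] at this
        simpa [had] using this.symm
      · exact htrip _ _ _ (Ne.symm h2) (Ne.symm h1) (Ne.symm h3)
    refine ⟨diagonal fun i => a i i₀, diagonal fun j => a i₀ j, Or.inl fun X => ?_⟩
    have : f = LinearMap.mulRight K (diagonal fun j => a i₀ j) ∘ₗ
        LinearMap.mulLeft K (diagonal fun i => a i i₀) := by
      refine ext_linearMap K fun i j => ?_
      ext k l
      by_cases hij : i = j
      · subst hij
        have := hmul i i
        rw [had] at this
        simp [hd, single_apply]
        grind
      · simp [hfs i j hij, hb0 i j hij, hmul i j, single_apply]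
        grind
    rw [this]; rfl
  · push Not at hP
    have hmul (k l : n) : b k l = b k i₀ * b i₀ l := by
      by_cases h1 : k = i₀
      · subst h1; simp [hbd]
      by_cases h2 : l = i₀
      · subst h2; simp [hbd]
      by_cases h3 : k = l
      · subst h3
        have := hpair k i₀ h1
        rw [hP _ _ h1, hP _ _ (Ne.symm h1)] at this
        simpa [hbd, mul_comm] using this.symm
      · exact htrip' _ _ _ (Ne.symm h2) (Ne.symm h1) (Ne.symm h3)
    refine ⟨diagonal fun i => b i₀ i, diagonal fun j => b j i₀, Or.inr fun X => ?_⟩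
    have : f = LinearMap.mulRight K (diagonal fun j => b j i₀) ∘ₗ
        LinearMap.mulLeft K (diagonal fun i => b i₀ i) ∘ₗ
        (transposeLinearEquiv n n K K).toLinearMap := by
      refine ext_linearMap K fun i j => ?_
      ext k l
      by_cases hij : i = j
      · subst hij
        have := hmul i i
        rw [hbd] at this
        simp [hd, single_apply]
        grind
      · simp [hfs i j hij, hP i j hij, hmul i j, single_apply]
        grind
    rw [this]; rfl

/-- **Marcus–Moyls theorem** for square matrices. -/
theorem Matrix.exists_mul_mul_of_rank_eq [Nonempty n] (M : Matrix n n K →ₗ[K] Matrix n n K)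
    (hM : ∀ X, (M X).rank = X.rank) :
    ∃ A B : Matrix n n K, IsUnit A.det ∧ IsUnit B.det ∧
      ((∀ X, M X = A * X * B) ∨ (∀ X, M X = A * Xᵀ * B)) := by
  have hI : IsUnit (M 1).det := by
    rw [← isUnit_iff_isUnit_det, ← mulVec_surjective_iff_isUnit]
    refine (LinearMap.range_eq_top (f := (M 1).mulVecLin)).1
      (Submodule.eq_top_of_finrank_eq ?_)
    rw [Module.finrank_fintype_fun_eq_card]
    exact (hM 1).trans rank_one
  have h1 (x y : n → K) : (M (vecMulVec x y)).rank ≤ 1 := (hM _).trans_le (rank_vecMulVec_le _ _)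
  suffices h : ∃ A B : Matrix n n K, (∀ X, M X = A * X * B) ∨ (∀ X, M X = A * Xᵀ * B) by
    obtain ⟨A, B, h⟩ := h
    have h' : M 1 = A * B := by rcases h with h | h <;> simp [h]
    rw [h', det_mul, IsUnit.mul_iff] at hI
    exact ⟨A, B, hI.1, hI.2, h⟩
  -- The diagonal units have images `u i * (v i)ᵀ`, whose sum `M 1 = U * V` is invertible.
  -- Multiplying `M` by `U⁻¹` and `V⁻¹` therefore reduces to a map fixing the diagonal units.
  choose u v huv using fun i : n => exists_eq_vecMulVec_of_rank_le_one
    (A := M (single i i 1)) (by rw [single_eq_single_vecMulVec_single]; exact h1 _ _)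
  have hUV : M 1 = (of u)ᵀ * of v := by
    have : (1 : Matrix n n K) = ∑ i, single i i 1 := by
      ext k l
      simp [sum_apply, single_apply, one_apply, ite_and]
    rw [this, map_sum]
    ext k l
    simp [huv, sum_apply, vecMulVec_apply, mul_apply]
  have hunit := hI
  rw [hUV, det_mul, IsUnit.mul_iff] at hunit
  set U := (of u)ᵀ with hU
  set V := of v with hV
  obtain ⟨A, B, h⟩ := exists_diagonal_of_rank_le_one
    (LinearMap.mulRight K V⁻¹ ∘ₗ LinearMap.mulLeft K U⁻¹ ∘ₗ M)
    (fun x y => by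
      simp only [LinearMap.comp_apply, LinearMap.mulLeft_apply, LinearMap.mulRight_apply]
      exact (rank_mul_le_left _ _).trans ((rank_mul_le_right _ _).trans (h1 x y)))
    (fun i => by
      have : M (single i i 1) = U * single i i 1 * V := by
        ext k l
        simp [huv, vecMulVec_apply, mul_apply, single_apply, hU, hV, ite_and]
      simp only [LinearMap.comp_apply, LinearMap.mulLeft_apply, LinearMap.mulRight_apply]
      rw [this, mul_assoc U, nonsing_inv_mul_cancel_left _ _ hunit.1,
        mul_nonsing_inv_cancel_right _ _ hunit.2])
  refine ⟨U * A, B * V, ?_⟩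
  have hback (X : Matrix n n K) : M X = U * (U⁻¹ * M X * V⁻¹) * V := by
    rw [mul_assoc U⁻¹, mul_nonsing_inv_cancel_left _ _ hunit.1,
      nonsing_inv_mul_cancel_right _ _ hunit.2]
  rcases h with h | h
  · exact Or.inl fun X => (hback X).trans (by
      rw [show U⁻¹ * M X * V⁻¹ = _ from h X]; simp only [mul_assoc])
  · exact Or.inr fun X => (hback X).trans (by
      rw [show U⁻¹ * M X * V⁻¹ = _ from h X]; simp only [mul_assoc])

end RankPreserver

/-- Singular value decomposition of an invertible real matrix. -/
theorem Matrix.exists_orthogonal_mul_diagonal_mul {n : Type*} [Fintype n] [DecidableEq n]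
    {W : Matrix n n ℝ} (hW : IsUnit W.det) :
    ∃ U ∈ Matrix.orthogonalGroup n ℝ, ∃ V ∈ Matrix.orthogonalGroup n ℝ, ∃ d : n → ℝ,
      (∀ i, 0 < d i) ∧ W = U * Matrix.diagonal d * V := by
  have hA : (Wᴴ * W).PosDef :=
    PosDef.conjTranspose_mul_self _ (mulVec_injective_iff_isUnit.2 ((isUnit_iff_isUnit_det _).2 hW))
  set P : Matrix n n ℝ := (hA.1.eigenvectorUnitary : Matrix n n ℝ)
  set ev := hA.1.eigenvalues
  have hpos : ∀ i, 0 < ev i := hA.eigenvalues_pos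
  have hPmem : P ∈ Matrix.orthogonalGroup n ℝ := hA.1.eigenvectorUnitary.2
  have hP1 : P * Pᵀ = 1 := (mem_orthogonalGroup_iff n ℝ).1 hPmem
  have hP2 : Pᵀ * P = 1 := (mem_orthogonalGroup_iff' n ℝ).1 hPmem
  have hspec : Pᵀ * (Wᵀ * W) * P = diagonal ev := by
    have := hA.1.conjStarAlgAut_star_eigenvectorUnitary
    rw [Unitary.conjStarAlgAut_star_apply] at this
    simp only [star_eq_conjTranspose, conjTranspose_eq_transpose_of_trivial] at this
    exact this
  have hsq (i : n) : √(ev i) ≠ 0 := (Real.sqrt_pos.2 (hpos i)).ne'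
  refine ⟨W * P * diagonal fun i => (√(ev i))⁻¹, ?_, Pᵀ, ?_, fun i => √(ev i),
    fun i => Real.sqrt_pos.2 (hpos i), ?_⟩
  · rw [mem_orthogonalGroup_iff']
    simp only [transpose_mul, diagonal_transpose]
    calc _ = diagonal (fun i => (√(ev i))⁻¹) * (Pᵀ * (Wᵀ * W) * P) *
          diagonal (fun i => (√(ev i))⁻¹) := by simp only [mul_assoc]
      _ = 1 := by
        rw [hspec, diagonal_mul_diagonal, diagonal_mul_diagonal, ← diagonal_one]
        congr 1
        ext i
        have := Real.mul_self_sqrt (hpos i).le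
        have := hsq i
        field_simp
        nlinarith
  · rw [mem_orthogonalGroup_iff, transpose_transpose, hP2]
  · rw [mul_assoc (W * P), diagonal_mul_diagonal]
    simp [inv_mul_cancel₀ (hsq _), mul_assoc, hP1]

/-! ### Rigidity of nearly doubly stochastic diagonal scalings. -/

section Scaling

variable {ι : Type*} [Fintype ι]

/-- Split `c j = a + (c j - a)`: the constant part sees only the total of `y`, and the extreme value
`l` is used only for the excess. This split is the source of the contraction. -/
theorem le_sum_mul_of_le {c y : ι → ℝ} {a l s : ℝ} (hc : ∀ j, a ≤ c j) (hy : ∀ j, l ≤ y j)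
    (hl : 0 ≤ l) (hs : s ≤ ∑ j, c j) :
    l * (s - a * Fintype.card ι) + a * ∑ j, y j ≤ ∑ j, c j * y j := by
  have h : ∑ j, (c j - a) * l ≤ ∑ j, (c j - a) * y j :=
    Finset.sum_le_sum fun j _ => mul_le_mul_of_nonneg_left (hy j) (sub_nonneg.2 (hc j))
  simp only [sub_mul, Finset.sum_sub_distrib, ← Finset.mul_sum, ← Finset.sum_mul,
    Finset.sum_const, Finset.card_univ, nsmul_eq_mul] at h
  nlinarith

theorem sum_mul_le_of_le {c y : ι → ℝ} {a u s : ℝ} (hc : ∀ j, a ≤ c j) (hy : ∀ j, y j ≤ u)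
    (hu : 0 ≤ u) (hs : ∑ j, c j ≤ s) :
    ∑ j, c j * y j ≤ u * (s - a * Fintype.card ι) + a * ∑ j, y j := by
  have h : ∑ j, (c j - a) * y j ≤ ∑ j, (c j - a) * u :=
    Finset.sum_le_sum fun j _ => mul_le_mul_of_nonneg_left (hy j) (sub_nonneg.2 (hc j))
  simp only [sub_mul, Finset.sum_sub_distrib, ← Finset.mul_sum, ← Finset.sum_mul,
    Finset.sum_const, Finset.card_univ, nsmul_eq_mul] at h
  nlinarith

/-- If the rows of `C` sum to about its size, and so do those of `diag x * C * diag y`, then the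
spread of `x` is controlled by that of `y`. -/
theorem spread_le_of_row_sums [Nonempty ι] {C : ι → ι → ℝ} {x y : ι → ℝ} {a ε l u : ℝ}
    (ha : 0 ≤ a) (hC : ∀ i j, a ≤ C i j) (hx : ∀ i, 0 < x i)
    (hl : 0 < l) (hly : ∀ j, l ≤ y j) (hyu : ∀ j, y j ≤ u)
    (hrow : ∀ i, |∑ j, C i j - Fintype.card ι| ≤ ε * Fintype.card ι)
    (hrow' : ∀ i, ∑ j, x i * y j * C i j = Fintype.card ι) {i i' : ι} (hii : x i' ≤ x i) :
    x i * l * (1 - ε) ≤ 1 ∧ 1 ≤ x i' * u * (1 + ε) ∧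
      x i * (1 - ε) * l ≤ x i' * ((1 + ε) * l + (1 - a + ε) * (u - l)) := by
  have hq : (0 : ℝ) < Fintype.card ι := Nat.cast_pos.2 Fintype.card_pos
  set q : ℝ := (Fintype.card ι : ℝ)
  have hlu : l ≤ u := (hly i).trans (hyu i)
  have hu : 0 < u := hl.trans_le hlu
  obtain ⟨m, hm⟩ : ∃ m, ∑ j, y j = q * m := ⟨(∑ j, y j) / q, by field_simp⟩
  have hlm : l ≤ m := by
    have : ∑ _j : ι, l ≤ ∑ j, y j := Finset.sum_le_sum fun j _ => hly j
    simp only [Finset.sum_const, Finset.card_univ, nsmul_eq_mul, hm] at this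
    exact le_of_mul_le_mul_left this hq
  have hmu : m ≤ u := by
    have : ∑ j, y j ≤ ∑ _j : ι, u := Finset.sum_le_sum fun j _ => hyu j
    simp only [Finset.sum_const, Finset.card_univ, nsmul_eq_mul, hm] at this
    exact le_of_mul_le_mul_left this hq
  have hxs (k : ι) : x k * ∑ j, C k j * y j = q := by
    rw [← hrow' k, Finset.mul_sum]
    exact Finset.sum_congr rfl fun j _ => by ring
  have h1 : x i * (l * (1 - ε - a) + a * m) ≤ 1 := by
    have := le_sum_mul_of_le (hC i) hly hl.le (s := q - ε * q)
      (by linarith [(abs_le.1 (hrow i)).1])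
    have := mul_le_mul_of_nonneg_left this (hx i).le
    rw [hxs, hm] at this
    refine le_of_mul_le_mul_left ?_ hq
    linarith
  have h2 : 1 ≤ x i' * (u * (1 + ε - a) + a * m) := by
    have := sum_mul_le_of_le (hC i') hyu hu.le (s := q + ε * q)
      (by linarith [(abs_le.1 (hrow i')).2])
    have := mul_le_mul_of_nonneg_left this (hx i').le
    rw [hxs, hm] at this
    refine le_of_mul_le_mul_left ?_ hq
    linarith
  have h3 : 0 ≤ x i * (a * (m - l)) :=
    mul_nonneg (hx i).le (mul_nonneg ha (sub_nonneg.2 hlm))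
  have h4 : 0 ≤ x i' * (a * (u - m)) :=
    mul_nonneg (hx i').le (mul_nonneg ha (sub_nonneg.2 hmu))
  -- The mean `m` enters `h1` and `h2` with the same weight `a`. Since `x i' ≤ x i`, its excess over
  -- `l` cancels, leaving the spread `u - l` with factor `1 - a + ε`.
  have h5 : 0 ≤ (x i - x i') * (a * (m - l)) :=
    mul_nonneg (sub_nonneg.2 hii) (mul_nonneg ha (sub_nonneg.2 hlm))
  exact ⟨by linarith, by linarith, by linarith⟩

/-- If `C` is nearly doubly stochastic (up to normalization) with entries bounded below and
`diag x * C * diag y` is doubly stochastic, then all `x i * y j` are close to one. -/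
theorem abs_mul_sub_one_le_of_doubly_stochastic [Nonempty ι] {C : ι → ι → ℝ} {x y : ι → ℝ} {ε : ℝ}
    (hε : 0 ≤ ε) (hε' : ε ≤ 1 / 50) (hC : ∀ i j, 1 / 2 ≤ C i j)
    (hx : ∀ i, 0 < x i) (hy : ∀ i, 0 < y i)
    (hrow : ∀ i, |∑ j, C i j - Fintype.card ι| ≤ ε * Fintype.card ι)
    (hcol : ∀ j, |∑ i, C i j - Fintype.card ι| ≤ ε * Fintype.card ι)
    (hrow' : ∀ i, ∑ j, x i * y j * C i j = Fintype.card ι)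
    (hcol' : ∀ j, ∑ i, x i * y j * C i j = Fintype.card ι) (i j : ι) :
    |x i * y j - 1| ≤ 11 * ε := by
  obtain ⟨iM, hiM⟩ := Finite.exists_max x
  obtain ⟨im, him⟩ := Finite.exists_min x
  obtain ⟨jM, hjM⟩ := Finite.exists_max y
  obtain ⟨jm, hjm⟩ := Finite.exists_min y
  obtain ⟨a1, a2, a3⟩ := spread_le_of_row_sums (by norm_num) hC hx (hy jm) hjm hjM hrow hrow'
    (him iM)
  obtain ⟨-, -, b3⟩ := spread_le_of_row_sums (C := fun j i => C i j) (by norm_num)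
    (fun j i => hC i j) hy (hx im) him hiM hcol
    (fun j => by simpa only [mul_comm (y j)] using hcol' j) (hjm jM)
  have hxm := hx im
  have hym := hy jm
  obtain ⟨β, hβ⟩ : ∃ β, x iM = x im * β := ⟨x iM / x im, by field_simp⟩
  obtain ⟨α, hα⟩ : ∃ α, y jM = y jm * α := ⟨y jM / y jm, by field_simp⟩
  have hα1 : 1 ≤ α := by
    have := hjm jM
    rw [hα] at this
    exact le_of_mul_le_mul_left (by linarith) hym
  have hβ1 : 1 ≤ β := by
    have := him iM
    rw [hβ] at this
    exact le_of_mul_le_mul_left (by linarith) hxm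
  have hp : 0 < x im * y jm := mul_pos hxm hym
  rw [hα, hβ] at a3
  rw [hα, hβ] at b3
  have a3' : β * (1 - ε) ≤ 1 + ε + (1 / 2 + ε) * (α - 1) := by
    refine le_of_mul_le_mul_left ?_ hp
    linarith
  have b3' : α * (1 - ε) ≤ 1 + ε + (1 / 2 + ε) * (β - 1) := by
    refine le_of_mul_le_mul_left ?_ hp
    linarith
  -- Adding `a3'` and `b3'` gives `(1 / 2 - 2 * ε) * (α + β - 2) ≤ 4 * ε`; the 9 comes from `ε ≤ 1 /
  -- 50`.
  have hsum : α + β - 2 ≤ 9 * ε := by nlinarith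
  have hα9 : α ≤ 1 + 9 * ε := by linarith
  have hup : x i * y j ≤ x iM * y jM := mul_le_mul (hiM i) (hjM j) (hy j).le (hx iM).le
  have hlo : x im * y jm ≤ x i * y j := mul_le_mul (him i) (hjm j) hym.le (hx i).le
  have hup' : x iM * y jM * (1 - ε) ≤ α := by
    rw [hα]
    have := mul_le_mul_of_nonneg_right a1 (by linarith : 0 ≤ α)
    linarith
  have hlo' : 1 ≤ x im * y jm * ((1 + 9 * ε) * (1 + ε)) := by
    rw [hα] at a2
    refine a2.trans ?_
    have := mul_le_mul_of_nonneg_left hα9 (by positivity : 0 ≤ x im * y jm * (1 + ε))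
    linarith
  rw [abs_le]
  constructor
  · nlinarith [mul_pos (hx i) (hy j), mul_nonneg hε (mul_pos (hx i) (hy j)).le]
  · nlinarith

end Scaling

/-! ### Frobenius norm and orthogonal invariance. -/

theorem Matrix.frobenius_norm_sq_eq_sum {q : ℕ} (A : Mat q) : ‖A‖ ^ 2 = ∑ i, ∑ j, A i j ^ 2 := by
  rw [Matrix.frobenius_norm_def, ← Real.sqrt_eq_rpow, Real.sq_sqrt (by positivity)]
  simp

theorem Matrix.frobenius_norm_sq_eq_trace {q : ℕ} (A : Mat q) : ‖A‖ ^ 2 = (Aᵀ * A).trace := by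
  rw [frobenius_norm_sq_eq_sum, Finset.sum_comm]
  simp [trace, mul_apply, sq]

theorem Matrix.frobenius_norm_orthogonal_mul {q : ℕ} {U : Mat q}
    (hU : U ∈ Matrix.orthogonalGroup (Fin q) ℝ) (A : Mat q) : ‖U * A‖ = ‖A‖ := by
  rw [← sq_eq_sq₀ (norm_nonneg _) (norm_nonneg _), frobenius_norm_sq_eq_trace,
    frobenius_norm_sq_eq_trace, transpose_mul, mul_assoc, ← mul_assoc Uᵀ,
    (mem_orthogonalGroup_iff' _ _).1 hU, one_mul]

theorem Matrix.frobenius_norm_mul_orthogonal {q : ℕ} {U : Mat q}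
    (hU : U ∈ Matrix.orthogonalGroup (Fin q) ℝ) (A : Mat q) : ‖A * U‖ = ‖A‖ := by
  rw [← frobenius_norm_transpose, transpose_mul, frobenius_norm_orthogonal_mul,
    frobenius_norm_transpose]
  rw [mem_orthogonalGroup_iff, transpose_transpose]
  exact (mem_orthogonalGroup_iff' _ _).1 hU

theorem Matrix.frobenius_norm_single_one {q : ℕ} (i j : Fin q) :
    ‖(Matrix.single i j 1 : Mat q)‖ = 1 := by
  rw [← sq_eq_sq₀ (norm_nonneg _) zero_le_one, frobenius_norm_sq_eq_sum]
  simp [single_apply, ite_and]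

theorem Matrix.transpose_mem_orthogonalGroup {q : ℕ} {U : Mat q}
    (hU : U ∈ Matrix.orthogonalGroup (Fin q) ℝ) : Uᵀ ∈ Matrix.orthogonalGroup (Fin q) ℝ := by
  rw [mem_orthogonalGroup_iff, transpose_transpose]
  exact (mem_orthogonalGroup_iff' _ _).1 hU

/-- The linear map `X ↦ A * X * B`. -/
def mulLeftRight {q : ℕ} (A B : Mat q) : Mat q →ₗ[ℝ] Mat q :=
  LinearMap.mulRight ℝ B ∘ₗ LinearMap.mulLeft ℝ A

@[simp]
theorem mulLeftRight_apply {q : ℕ} (A B X : Mat q) : mulLeftRight A B X = A * X * B := rfl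

/-- For the trace pairing, the adjoint of `X ↦ A * X * B` is `Φ ↦ Aᵀ * Φ * Bᵀ`. Invariance of the
Euclidean norm and of normalization under rotations both rest on this. -/
theorem LinearMap.apply_mul_single_mul {q : ℕ} (φ : Mat q →ₗ[ℝ] ℝ) (A B : Mat q) (i j : Fin q) :
    φ (A * Matrix.single i j 1 * B) =
      (Aᵀ * Matrix.of (fun k l => φ (Matrix.single k l 1)) * Bᵀ) i j := by
  have h : A * Matrix.single i j 1 * B =
      ∑ k, ∑ l, (A k i * B j l) • (Matrix.single k l 1 : Mat q) := by
    ext a b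
    simp [Matrix.mul_apply, Matrix.sum_apply, Matrix.single_apply, ite_and]
  rw [h]
  simp only [map_sum, map_smul, smul_eq_mul, Matrix.mul_apply, Matrix.transpose_apply,
    Matrix.of_apply, Finset.sum_mul]
  rw [Finset.sum_comm]
  exact Finset.sum_congr rfl fun k _ => Finset.sum_congr rfl fun l _ => by ring

theorem sum_apply_orthogonal_mul_single_mul_sq {q : ℕ} (φ : Mat q →ₗ[ℝ] ℝ) {U V : Mat q}
    (hU : U ∈ Matrix.orthogonalGroup (Fin q) ℝ) (hV : V ∈ Matrix.orthogonalGroup (Fin q) ℝ) :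
    ∑ i, ∑ j, φ (U * Matrix.single i j 1 * V) ^ 2 = ∑ i, ∑ j, φ (Matrix.single i j 1) ^ 2 := by
  simp only [LinearMap.apply_mul_single_mul]
  rw [← Matrix.frobenius_norm_sq_eq_sum, Matrix.frobenius_norm_mul_orthogonal
    (Matrix.transpose_mem_orthogonalGroup hV), Matrix.frobenius_norm_orthogonal_mul
    (Matrix.transpose_mem_orthogonalGroup hU), Matrix.frobenius_norm_sq_eq_sum]
  simp

/-- Orthogonal invariance of the Euclidean norm of operators. -/
theorem sum_norm_apply_orthogonal_mul_single_mul_sq {q : ℕ} (E : Mat q →ₗ[ℝ] Mat q) {U V : Mat q}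
    (hU : U ∈ Matrix.orthogonalGroup (Fin q) ℝ) (hV : V ∈ Matrix.orthogonalGroup (Fin q) ℝ) :
    ∑ i, ∑ j, ‖E (U * Matrix.single i j 1 * V)‖ ^ 2 = euclideanNorm E ^ 2 := by
  rw [euclideanNorm, Real.sq_sqrt (by positivity)]
  have key (F : Fin q → Fin q → Mat q) :
      ∑ i, ∑ j, ‖F i j‖ ^ 2 = ∑ k, ∑ l, ∑ i, ∑ j, F i j k l ^ 2 := by
    simp only [Matrix.frobenius_norm_sq_eq_sum]
    calc _ = ∑ p : Fin q × Fin q, ∑ r : Fin q × Fin q, F p.1 p.2 r.1 r.2 ^ 2 := by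
          simp only [Fintype.sum_prod_type]
      _ = ∑ r : Fin q × Fin q, ∑ p : Fin q × Fin q, F p.1 p.2 r.1 r.2 ^ 2 := Finset.sum_comm
      _ = _ := by simp only [Fintype.sum_prod_type]
  rw [key, key]
  exact Finset.sum_congr rfl fun k _ => Finset.sum_congr rfl fun l _ =>
    sum_apply_orthogonal_mul_single_mul_sq (Matrix.entryLinearMap ℝ ℝ k l ∘ₗ E) hU hV

/-! ### Normalized maps. -/

section Normalized

variable {q d : ℕ} {L : Mat q →ₗ[ℝ] EuclideanSpace ℝ (Fin d)}

theorem componentMatrix_comp_mulLeftRight (L : Mat q →ₗ[ℝ] EuclideanSpace ℝ (Fin d)) (A B : Mat q)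
    (i : Fin d) :
    componentMatrix (L ∘ₗ mulLeftRight A B) i = Aᵀ * componentMatrix L i * Bᵀ := by
  ext j k
  exact LinearMap.apply_mul_single_mul ((EuclideanSpace.proj i).toLinearMap ∘ₗ L) A B j k

theorem IsNormalizedMap.comp_mulLeftRight (hL : IsNormalizedMap L) {U V : Mat q}
    (hU : U ∈ Matrix.orthogonalGroup (Fin q) ℝ) (hV : V ∈ Matrix.orthogonalGroup (Fin q) ℝ) :
    IsNormalizedMap (L ∘ₗ mulLeftRight U V) := by
  have hU' := (Matrix.mem_orthogonalGroup_iff _ _).1 hU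
  have hU'' := (Matrix.mem_orthogonalGroup_iff' _ _).1 hU
  have hV' := (Matrix.mem_orthogonalGroup_iff _ _).1 hV
  have hV'' := (Matrix.mem_orthogonalGroup_iff' _ _).1 hV
  constructor
  · calc _ = ∑ i, Uᵀ * (componentMatrix L i * (componentMatrix L i)ᵀ) * U :=
          Finset.sum_congr rfl fun i _ => by
            rw [componentMatrix_comp_mulLeftRight]
            simp only [Matrix.transpose_mul, Matrix.transpose_transpose, mul_assoc]
            rw [← mul_assoc Vᵀ, hV'', one_mul]
      _ = _ := by
        rw [← Finset.sum_mul, ← Finset.mul_sum, hL.1]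
        simp [hU'']
  · calc _ = ∑ i, V * ((componentMatrix L i)ᵀ * componentMatrix L i) * Vᵀ :=
          Finset.sum_congr rfl fun i _ => by
            rw [componentMatrix_comp_mulLeftRight]
            simp only [Matrix.transpose_mul, Matrix.transpose_transpose, mul_assoc]
            rw [← mul_assoc U, hU', one_mul]
      _ = _ := by
        rw [← Finset.sum_mul, ← Finset.mul_sum, hL.2]
        simp [hV']

theorem IsNormalizedMap.comp_transpose (hL : IsNormalizedMap L) :
    IsNormalizedMap (L ∘ₗ (Matrix.transposeLinearEquiv (Fin q) (Fin q) ℝ ℝ).toLinearMap) := by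
  have h (i : Fin d) : componentMatrix
      (L ∘ₗ (Matrix.transposeLinearEquiv (Fin q) (Fin q) ℝ ℝ).toLinearMap) i =
      (componentMatrix L i)ᵀ := by
    ext j k
    simp [componentMatrix]
  simp only [IsNormalizedMap, h, Matrix.transpose_transpose]
  exact hL.symm

/-- A diagonal entry of the first normalization identity; off-diagonal entries matter only through
invariance under rotations. -/
theorem IsNormalizedMap.sum_row (hL : IsNormalizedMap L) (j : Fin q) :
    ∑ k, ‖L (Matrix.single j k 1)‖ ^ 2 = q := by
  have := congrFun (congrFun hL.1 j) j
  simp only [Matrix.sum_apply, Matrix.mul_apply, Matrix.smul_apply, Matrix.one_apply_eq,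
    smul_eq_mul, mul_one, Matrix.transpose_apply, componentMatrix, Matrix.of_apply] at this
  rw [← this, Finset.sum_comm]
  simp only [EuclideanSpace.norm_sq_eq, Real.norm_eq_abs, sq_abs]
  simp only [sq]

theorem IsNormalizedMap.sum_col (hL : IsNormalizedMap L) (k : Fin q) :
    ∑ j, ‖L (Matrix.single j k 1)‖ ^ 2 = q := by
  have := congrFun (congrFun hL.2 k) k
  simp only [Matrix.sum_apply, Matrix.mul_apply, Matrix.smul_apply, Matrix.one_apply_eq,
    smul_eq_mul, mul_one, Matrix.transpose_apply, componentMatrix, Matrix.of_apply] at this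
  rw [← this, Finset.sum_comm]
  simp only [EuclideanSpace.norm_sq_eq, Real.norm_eq_abs, sq_abs]
  simp only [sq]

end Normalized

/-! ### Norm estimates and restricted isometry. -/

section SpectralNorm

variable {V W : Type*} [NormedAddCommGroup V] [NormedSpace ℝ V] [FiniteDimensional ℝ V]
  [NormedAddCommGroup W] [NormedSpace ℝ W]

theorem le_spectralNorm2 (A : V →ₗ[ℝ] W) (x : V) : ‖A x‖ ≤ spectralNorm2 A * ‖x‖ :=
  (LinearMap.toContinuousLinearMap A).le_opNorm x

theorem spectralNorm2_nonneg (A : V →ₗ[ℝ] W) : 0 ≤ spectralNorm2 A := norm_nonneg _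

theorem spectralNorm2_le (A : V →ₗ[ℝ] W) {c : ℝ} (hc : 0 ≤ c) (h : ∀ x, ‖A x‖ ≤ c * ‖x‖) :
    spectralNorm2 A ≤ c :=
  ContinuousLinearMap.opNorm_le_bound _ hc h

end SpectralNorm

/-- The inequality on `γ` is strict so that an admissible `δ` below `γ` exists without showing that
the infimum is attained. -/
theorem le_norm_sq_of_restrictedIsometryConst_lt {q d k : ℕ}
    {L : Mat q →ₗ[ℝ] EuclideanSpace ℝ (Fin d)} {γ : ℝ} (h : restrictedIsometryConst k L < γ)
    {X : Mat q} (hX : X.rank ≤ k) : (1 - γ) * ‖X‖ ^ 2 ≤ ‖L X‖ ^ 2 := by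
  by_cases hX0 : X = 0
  · simp [hX0]
  have hne : {δ : ℝ | ∀ X : Mat q, X ≠ 0 → X.rank ≤ k →
      1 - δ ≤ ‖L X‖ ^ 2 / ‖X‖ ^ 2 ∧ ‖L X‖ ^ 2 / ‖X‖ ^ 2 ≤ 1 + δ}.Nonempty := by
    refine ⟨1 + spectralNorm2 L ^ 2, fun X hX _ => ⟨?_, ?_⟩⟩
    · have : 0 ≤ ‖L X‖ ^ 2 / ‖X‖ ^ 2 := by positivity
      nlinarith [sq_nonneg (spectralNorm2 L)]
    · rw [div_le_iff₀ (by positivity)]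
      have := pow_le_pow_left₀ (norm_nonneg _) (le_spectralNorm2 L X) 2
      nlinarith [sq_nonneg ‖X‖]
  obtain ⟨δ, hδ, hlt⟩ := exists_lt_of_csInf_lt hne h
  have := (hδ X hX0 hX).1
  rw [le_div_iff₀ (by positivity)] at this
  nlinarith [sq_nonneg ‖X‖]

theorem abs_sum_norm_add_sq_sub_le {ι F : Type*} [Fintype ι] [NormedAddCommGroup F]
    [InnerProductSpace ℝ F] (u v : ι → F) {s r : ℝ} (hs : 0 ≤ s) (hr : 0 ≤ r)
    (hu : ∑ i, ‖u i‖ ^ 2 = s ^ 2) (hv : ∑ i, ‖v i‖ ^ 2 ≤ r ^ 2) :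
    |∑ i, ‖u i + v i‖ ^ 2 - s ^ 2| ≤ 2 * s * r + r ^ 2 := by
  have h1 : |∑ i, inner ℝ (u i) (v i)| ≤ s * r := by
    calc |∑ i, inner ℝ (u i) (v i)| ≤ ∑ i, ‖u i‖ * ‖v i‖ :=
          (Finset.abs_sum_le_sum_abs _ _).trans
            (Finset.sum_le_sum fun i _ => abs_real_inner_le_norm _ _)
      _ ≤ s * r := by
        refine abs_le_of_sq_le_sq' ?_ (by positivity) |>.2
        calc _ ≤ (∑ i, ‖u i‖ ^ 2) * ∑ i, ‖v i‖ ^ 2 := Finset.sum_mul_sq_le_sq_mul_sq _ _ _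
          _ ≤ s ^ 2 * r ^ 2 := by rw [hu]; gcongr
          _ = _ := by ring
  have h2 : ∑ i, ‖u i + v i‖ ^ 2 =
      s ^ 2 + 2 * ∑ i, inner ℝ (u i) (v i) + ∑ i, ‖v i‖ ^ 2 := by
    simp only [norm_add_sq_real, Finset.sum_add_distrib, hu, Finset.mul_sum]
  have h3 : 0 ≤ ∑ i, ‖v i‖ ^ 2 := by positivity
  rw [h2, abs_le]
  have := abs_le.1 h1
  constructor <;> linarith

theorem spectralNorm2_mul_euclideanNorm_le {q d : ℕ}
    {Lstar : Mat q →ₗ[ℝ] EuclideanSpace ℝ (Fin d)} {E : Mat q →ₗ[ℝ] Mat q}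
    (hE : euclideanNorm E ≤ 1 / (150 * √(q : ℝ) * spectralNorm2 Lstar)) :
    √(q : ℝ) * (spectralNorm2 Lstar * euclideanNorm E) ≤ 1 / 150 := by
  have hs : 0 ≤ √(q : ℝ) * spectralNorm2 Lstar :=
    mul_nonneg (Real.sqrt_nonneg _) (spectralNorm2_nonneg _)
  -- If the denominator vanishes, `hE` reads as division by zero, but then the product to be bounded
  -- is zero as well.
  rcases hs.eq_or_lt with h0 | h0
  · rw [← mul_assoc, ← h0, zero_mul]
    norm_num
  · rw [le_div_iff₀ (by linarith)] at hE
    linarith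

/-! ### Comparison with an orthogonal rank-preserver. -/

theorem exists_orthogonal_near_of_isNormalizedMap {q d : ℕ} (hq : 1 ≤ q)
    {L Lstar : Mat q →ₗ[ℝ] EuclideanSpace ℝ (Fin d)}
    (hL : IsNormalizedMap L) (hLstar : IsNormalizedMap Lstar)
    (hδ : restrictedIsometryConst 1 Lstar ≤ 1 / 10)
    {E : Mat q →ₗ[ℝ] Mat q} {A B : Mat q} (hA : IsUnit A.det) (hB : IsUnit B.det)
    (hfactor : ∀ X, L X = Lstar (A * X * B + E (A * X * B)))
    (hE : √(q : ℝ) * (spectralNorm2 Lstar * euclideanNorm E) ≤ 1 / 150) :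
    ∃ P ∈ Matrix.orthogonalGroup (Fin q) ℝ, ∃ Q ∈ Matrix.orthogonalGroup (Fin q) ℝ,
      ∀ X, ‖P * X * Q - A * X * B‖ ≤
        33 * (√(q : ℝ) * (spectralNorm2 Lstar * euclideanNorm E)) * ‖X‖ := by
  obtain ⟨U₁, hU₁, V₁, hV₁, x, hx, rfl⟩ := Matrix.exists_orthogonal_mul_diagonal_mul hA
  obtain ⟨U₂, hU₂, V₂, hV₂, y, hy, rfl⟩ := Matrix.exists_orthogonal_mul_diagonal_mul hB
  have : Nonempty (Fin q) := ⟨⟨0, hq⟩⟩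
  set r := spectralNorm2 Lstar * euclideanNorm E with hr
  have hr0 : 0 ≤ r := mul_nonneg (spectralNorm2_nonneg _) (Real.sqrt_nonneg _)
  have hq1 : (1 : ℝ) ≤ q := by exact_mod_cast hq
  have hsq : 1 ≤ √(q : ℝ) := Real.one_le_sqrt.2 hq1
  have hsqq : √(q : ℝ) ^ 2 = q := Real.sq_sqrt (by linarith)
  have hrs : r ≤ √(q : ℝ) * r := le_mul_of_one_le_left hr0 hsq
  set u : Fin q → Fin q → EuclideanSpace ℝ (Fin d) :=
    fun i j => Lstar (U₁ * Matrix.single i j 1 * V₂)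
  set v : Fin q → Fin q → EuclideanSpace ℝ (Fin d) :=
    fun i j => Lstar (E (U₁ * Matrix.single i j 1 * V₂))
  have hstar := hLstar.comp_mulLeftRight hU₁ hV₂
  have hurow (i : Fin q) : ∑ j, ‖u i j‖ ^ 2 = √(q : ℝ) ^ 2 := by
    rw [hsqq]; exact hstar.sum_row i
  have hucol (j : Fin q) : ∑ i, ‖u i j‖ ^ 2 = √(q : ℝ) ^ 2 := by
    rw [hsqq]; exact hstar.sum_col j
  -- The Euclidean norm of `E` may be computed in the rotated units, so `r ^ 2` bounds the total
  -- perturbation and hence each row and column.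
  have hvsum : ∑ i, ∑ j, ‖v i j‖ ^ 2 ≤ r ^ 2 := by
    rw [hr, mul_pow, ← sum_norm_apply_orthogonal_mul_single_mul_sq E hU₁ hV₂, Finset.mul_sum]
    refine Finset.sum_le_sum fun i _ => ?_
    rw [Finset.mul_sum]
    refine Finset.sum_le_sum fun j _ => ?_
    rw [← mul_pow]
    exact pow_le_pow_left₀ (norm_nonneg _) (le_spectralNorm2 _ _) 2
  have hvrow (i : Fin q) : ∑ j, ‖v i j‖ ^ 2 ≤ r ^ 2 :=
    (Finset.single_le_sum (f := fun i => ∑ j, ‖v i j‖ ^ 2)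
      (fun _ _ => by positivity) (Finset.mem_univ i)).trans hvsum
  have hvcol (j : Fin q) : ∑ i, ‖v i j‖ ^ 2 ≤ r ^ 2 := by
    rw [Finset.sum_comm] at hvsum
    exact (Finset.single_le_sum (f := fun j => ∑ i, ‖v i j‖ ^ 2)
      (fun _ _ => by positivity) (Finset.mem_univ j)).trans hvsum
  have hv1 (i j : Fin q) : ‖v i j‖ ≤ 1 / 150 := by
    have : ‖v i j‖ ^ 2 ≤ r ^ 2 :=
      (Finset.single_le_sum (f := fun j => ‖v i j‖ ^ 2)
        (fun _ _ => by positivity) (Finset.mem_univ j)).trans (hvrow i)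
    linarith [(sq_le_sq₀ (norm_nonneg _) hr0).1 this]
  have hu1 (i j : Fin q) : 3 / 4 ≤ ‖u i j‖ ^ 2 := by
    have h : (U₁ * Matrix.single i j 1 * V₂).rank ≤ 1 := by
      refine (Matrix.rank_mul_le_left _ _).trans ((Matrix.rank_mul_le_right _ _).trans ?_)
      rw [Matrix.single_eq_single_vecMulVec_single]
      exact Matrix.rank_vecMulVec_le _ _
    -- Any `γ` above 1/10 is admissible; 1/4 leaves enough room for `C i j ≥ 1 / 2` after the
    -- perturbation.
    have := le_norm_sq_of_restrictedIsometryConst_lt (L := Lstar) (γ := 1 / 4) (by linarith) h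
    rw [Matrix.frobenius_norm_mul_orthogonal hV₂, Matrix.frobenius_norm_orthogonal_mul hU₁,
      Matrix.frobenius_norm_single_one] at this
    linarith
  have hC (i j : Fin q) : 1 / 2 ≤ ‖u i j + v i j‖ ^ 2 := by
    have h1 := norm_sub_le (u i j + v i j) (v i j)
    rw [add_sub_cancel_right] at h1
    have h2 : 4 / 5 ≤ ‖u i j‖ := by nlinarith [hu1 i j, norm_nonneg (u i j)]
    nlinarith [hv1 i j]
  -- This fixes the relative error `ε = 3 * (√q * r)`, which `hE` bounds by `3 / 150 = 1 / 50`, the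
  -- threshold of the scaling lemma.
  have hε : 2 * √(q : ℝ) * r + r ^ 2 ≤ 3 * (√(q : ℝ) * r) * q := by
    have h1 : √(q : ℝ) * r ≤ √(q : ℝ) * r * q := le_mul_of_one_le_right (by positivity) hq1
    have h2 : r * r ≤ √(q : ℝ) * r := mul_le_mul_of_nonneg_right (by linarith) hr0
    nlinarith
  have hdiag (i j : Fin q) : L (V₁ᵀ * Matrix.single i j 1 * U₂ᵀ) =
      (x i * y j) • (u i j + v i j) := by
    have h : U₁ * Matrix.diagonal x * V₁ * (V₁ᵀ * Matrix.single i j 1 * U₂ᵀ) *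
        (U₂ * Matrix.diagonal y * V₂) = (x i * y j) • (U₁ * Matrix.single i j 1 * V₂) := by
      calc _ = U₁ * (Matrix.diagonal x * (V₁ * V₁ᵀ) * Matrix.single i j 1 * (U₂ᵀ * U₂) *
            Matrix.diagonal y) * V₂ := by simp only [mul_assoc]
        _ = _ := by
          rw [(Matrix.mem_orthogonalGroup_iff _ _).1 hV₁,
            (Matrix.mem_orthogonalGroup_iff' _ _).1 hU₂, mul_one, mul_one]
          have : Matrix.diagonal x * Matrix.single i j 1 * Matrix.diagonal y =
              (x i * y j) • Matrix.single i j 1 := by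
            ext k l
            simp [Matrix.single_apply]
            grind
          rw [this, Matrix.mul_smul, Matrix.smul_mul]
    rw [hfactor, h, map_add, map_smul, map_smul, map_smul, smul_add]
  have hnorm := hL.comp_mulLeftRight (Matrix.transpose_mem_orthogonalGroup hV₁)
    (Matrix.transpose_mem_orthogonalGroup hU₂)
  have hnd (i j : Fin q) : x i ^ 2 * y j ^ 2 * ‖u i j + v i j‖ ^ 2 =
      ‖(L ∘ₗ mulLeftRight V₁ᵀ U₂ᵀ) (Matrix.single i j 1)‖ ^ 2 := by
    rw [LinearMap.comp_apply, mulLeftRight_apply, hdiag, norm_smul, mul_pow, Real.norm_eq_abs,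
      sq_abs, mul_pow]
  have hclose (i j : Fin q) : |x i ^ 2 * y j ^ 2 - 1| ≤ 11 * (3 * (√(q : ℝ) * r)) := by
    refine abs_mul_sub_one_le_of_doubly_stochastic (C := fun i j => ‖u i j + v i j‖ ^ 2)
      (x := fun i => x i ^ 2) (y := fun j => y j ^ 2) (by positivity) (by linarith) hC
      (fun i => pow_pos (hx i) 2) (fun j => pow_pos (hy j) 2) ?_ ?_ ?_ ?_ i j
    · intro i
      rw [Fintype.card_fin]
      have := abs_sum_norm_add_sq_sub_le (u i) (v i) (by positivity) hr0 (hurow i) (hvrow i)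
      rw [hsqq] at this
      exact this.trans hε
    · intro j
      rw [Fintype.card_fin]
      have := abs_sum_norm_add_sq_sub_le (fun i => u i j) (fun i => v i j) (by positivity) hr0
        (hucol j) (hvcol j)
      rw [hsqq] at this
      exact this.trans hε
    · intro i
      simp only [hnd, Fintype.card_fin]
      exact hnorm.sum_row i
    · intro j
      simp only [hnd, Fintype.card_fin]
      exact hnorm.sum_col j
  -- For `t > 0`, `|1 - t| ≤ |1 - t ^ 2|`; the constant is `33 = 11 * 3`.
  have hclose' (i j : Fin q) : (1 - x i * y j) ^ 2 ≤ (33 * (√(q : ℝ) * r)) ^ 2 := by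
    have hp := mul_pos (hx i) (hy j)
    rw [sq_le_sq, abs_of_nonneg (a := 33 * (√(q : ℝ) * r)) (by positivity)]
    calc |1 - x i * y j| ≤ |1 - x i * y j| * (1 + x i * y j) :=
          le_mul_of_one_le_right (abs_nonneg _) (by linarith)
      _ = |x i ^ 2 * y j ^ 2 - 1| := by
        rw [← abs_of_pos (by linarith : 0 < 1 + x i * y j), ← abs_mul, abs_sub_comm]
        congr 1
        ring
      _ ≤ _ := (hclose i j).trans (by linarith)
  refine ⟨U₁ * V₁, mul_mem hU₁ hV₁, U₂ * V₂, mul_mem hU₂ hV₂, fun X => ?_⟩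
  -- In rotated coordinates the difference multiplies entry `(i, j)` by `1 - x i * y j`, so an
  -- entrywise bound suffices.
  have hfac : U₁ * V₁ * X * (U₂ * V₂) -
      U₁ * Matrix.diagonal x * V₁ * X * (U₂ * Matrix.diagonal y * V₂) =
      U₁ * (V₁ * X * U₂ - Matrix.diagonal x * (V₁ * X * U₂) * Matrix.diagonal y) * V₂ := by
    simp only [mul_sub, sub_mul, mul_assoc]
  have hXY : ‖V₁ * X * U₂‖ = ‖X‖ := by
    rw [Matrix.frobenius_norm_mul_orthogonal hU₂, Matrix.frobenius_norm_orthogonal_mul hV₁]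
  rw [hfac, Matrix.frobenius_norm_mul_orthogonal hV₂, Matrix.frobenius_norm_orthogonal_mul hU₁,
    ← hXY]
  set Y := V₁ * X * U₂
  refine (sq_le_sq₀ (norm_nonneg _) (by positivity)).1 ?_
  rw [mul_pow, Matrix.frobenius_norm_sq_eq_sum, Matrix.frobenius_norm_sq_eq_sum, Finset.mul_sum]
  refine Finset.sum_le_sum fun i _ => ?_
  rw [Finset.mul_sum]
  refine Finset.sum_le_sum fun j _ => ?_
  have : (Y - Matrix.diagonal x * Y * Matrix.diagonal y) i j = (1 - x i * y j) * Y i j := by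
    simp
    ring
  rw [this, mul_pow]
  exact mul_le_mul_of_nonneg_right (hclose' i j) (sq_nonneg _)

theorem mainTheorem5 (q d : ℕ) (hq : 1 ≤ q)
    (L Lstar : Mat q →ₗ[ℝ] EuclideanSpace ℝ (Fin d))
    (hL : IsNormalizedMap L) (hLstar : IsNormalizedMap Lstar)
    (hδ : restrictedIsometryConst 1 Lstar ≤ 1 / 10)
    (E M : Mat q →ₗ[ℝ] Mat q) (hM : IsRankPreserver M)
    (hfactor : L = Lstar ∘ₗ (LinearMap.id + E) ∘ₗ M)
    (hE : euclideanNorm E ≤ 1 / (150 * √(q : ℝ) * spectralNorm2 Lstar)) :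
    ∃ Mor : Mat q →ₗ[ℝ] Mat q, IsOrthogonalRankPreserver Mor ∧
      spectralNorm2 (Mor - M) ≤ 300 * √(q : ℝ) * spectralNorm2 Lstar * euclideanNorm E := by
  have : Nonempty (Fin q) := ⟨⟨0, hq⟩⟩
  have hE' := spectralNorm2_mul_euclideanNorm_le hE
  have hr0 : 0 ≤ √(q : ℝ) * (spectralNorm2 Lstar * euclideanNorm E) :=
    mul_nonneg (Real.sqrt_nonneg _) (mul_nonneg (spectralNorm2_nonneg _) (Real.sqrt_nonneg _))
  have hbound (X : Mat q) : 33 * (√(q : ℝ) * (spectralNorm2 Lstar * euclideanNorm E)) * ‖X‖ ≤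
      300 * √(q : ℝ) * spectralNorm2 Lstar * euclideanNorm E * ‖X‖ :=
    mul_le_mul_of_nonneg_right (by linarith) (norm_nonneg _)
  obtain ⟨A, B, hA, hB, h | h⟩ := Matrix.exists_mul_mul_of_rank_eq M hM
  · obtain ⟨P, hP, Q, hQ, hPQ⟩ := exists_orthogonal_near_of_isNormalizedMap hq hL hLstar hδ hA hB
      (fun X => by rw [hfactor]; simp [h]) hE'
    refine ⟨mulLeftRight P Q, ⟨P, hP, Q, hQ, Or.inl fun _ => rfl⟩,
      spectralNorm2_le _ (by linarith) fun X => ?_⟩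
    rw [LinearMap.sub_apply, mulLeftRight_apply, h]
    exact (hPQ X).trans (hbound X)
  -- Precomposing `L` with transposition swaps its two normalization conditions and reduces to the
  -- plain case.
  · obtain ⟨P, hP, Q, hQ, hPQ⟩ := exists_orthogonal_near_of_isNormalizedMap hq hL.comp_transpose
      hLstar hδ hA hB (fun X => by rw [hfactor]; simp [h]) hE'
    refine ⟨mulLeftRight P Q ∘ₗ (Matrix.transposeLinearEquiv (Fin q) (Fin q) ℝ ℝ).toLinearMap,
      ⟨P, hP, Q, hQ, Or.inr fun _ => rfl⟩, spectralNorm2_le _ (by linarith) fun X => ?_⟩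
    have := (hPQ Xᵀ).trans (hbound Xᵀ)
    rw [Matrix.frobenius_norm_transpose] at this
    rw [LinearMap.sub_apply, h]
    exact this
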